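/- Let $K$ be a field, let $m,n\ge 0$, and let $\Delta$ be a simplicial complex on the vertex set $V\sqcup W$ with $V=\{v_1,\dots,v_m\}$ and $W=\{w_1,\dots,w_n\}$ (a family of subsets that is closed under taking subsets and contains $\emptyset$; it is not required that every single vertex be a face). Let $K[\Delta]=K[X_1,\dots,X_m,Y_1,\dots,Y_n]/I_\Delta$ be its Stanley–Reisner ring, where $I_\Delta$ is generated by the squarefree monomials corresponding to the non-faces of $\Delta$; let $x_i,y_j$ be the residue classes of $X_i,Y_j$, and give $K[\Delta]$ the $\mathbb Z\times\mathbb Z$-grading with $\deg x_i=(1,0)$ and $\deg y_j=(0,1)$. Put $P=(y_1,\dots,y_n)\subset K[\Delta]$. Let $\Delta_W=\{F\in\Delta : F\subseteq W\}$, and let $K[\Delta_W]=K[Y_1,\dots,Y_n]/I_{\Delta_W}$ be its Stanley–Reisner ring with the standard grading $\deg y_j=1$ and the ideal $\mathfrak m=(y_1,\dots,y_n)$. For $R=K[\Delta]$ (respectively $R=K[\Delta_W]$), the local cohomology $H^i_P(R)$ (respectively $H^i_{\mathfrak m}(R)$), $i\in\mathbb Z$, is the $i$-th cohomology of the Čech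 complex $C^{\bullet}$ with $C^t=\bigoplus_{1\le j_1<\dots<j_t\le n}R_{y_{j_1}\cdots y_{j_t}}$ and the usual alternating differential, graded through the grading of the localizations: for a product $y=y_{j_1}\cdots y_{j_t}$, the component $(R_y)_d$ consists of all $r/y^l$ with $r\in R$ homogeneous and $\deg r-l\deg y=d$. Then for all $i,j\in\mathbb Z$ $$\dim_K H^i_P(K[\Delta])_{(0,j)}=\dim_K H^i_{\mathfrak m}(K[\Delta_W])_j .$$ -/

import Mathlib

noncomputable section

namespace StanleyReisner

/-- The restriction `Δ_W` of a simplicial complex `Δ` on `V ⊔ W` to `W`: its faces are the faces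
of `Δ` all of whose vertices belong to `W`. (As in Mathlib, the empty face is left implicit.) -/
def restrictRight {V W : Type*} (Δ : PreAbstractSimplicialComplex (V ⊕ W)) :
    PreAbstractSimplicialComplex W where
  faces := {F | F.map Function.Embedding.inr ∈ Δ}
  isRelLowerSet_faces := fun {_} hF =>
    ⟨Finset.map_nonempty.1 (Δ.isRelLowerSet_faces hF).1, fun _ hle hne =>
      (Δ.isRelLowerSet_faces hF).2 (Finset.map_subset_map.2 hle) (Finset.map_nonempty.2 hne)⟩

/-- The Stanley-Reisner ideal `I_Δ`, generated by the squarefree monomials of the non-faces.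
The empty set always counts as a face. -/
def ideal (K : Type*) [Field K] {σ : Type*} (Δ : PreAbstractSimplicialComplex σ) :
    Ideal (MvPolynomial σ K) :=
  Ideal.span {p | ∃ F : Finset σ, F.Nonempty ∧ F ∉ Δ ∧ p = ∏ v ∈ F, MvPolynomial.X v}

/-- The Stanley-Reisner ring `K[Δ]`. -/
abbrev FaceRing (K : Type*) [Field K] {σ : Type*} (Δ : PreAbstractSimplicialComplex σ) : Type _ :=
  MvPolynomial σ K ⧸ ideal K Δ

/-- The residue class in `K[Δ]` of the variable belonging to the vertex `v`. -/
def var (K : Type*) [Field K] {σ : Type*} (Δ : PreAbstractSimplicialComplex σ) (v : σ) :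
    FaceRing K Δ :=
  Ideal.Quotient.mk (ideal K Δ) (MvPolynomial.X v)

/-- The homogeneous component of degree `d` of `K[Δ]`, where the variable of `v` has
degree `w v`. -/
def component (K : Type*) [Field K] {σ : Type*} (Δ : PreAbstractSimplicialComplex σ)
    {ι : Type*} [AddCommMonoid ι] (w : σ → ι) (d : ι) : Submodule K (FaceRing K Δ) :=
  (MvPolynomial.weightedHomogeneousSubmodule K w d).map
    (Ideal.Quotient.mkₐ K (ideal K Δ)).toLinearMap

end StanleyReisner

namespace Cech

/-- `A_{y_F}`, the localization of `A` at the powers of `∏ j ∈ F, y j`. -/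
abbrev Loc {A : Type*} [CommRing A] {n : ℕ} (y : Fin n → A) (F : Finset (Fin n)) : Type _ :=
  Localization.Away (∏ j ∈ F, y j)

theorem isUnit_algebraMap {A : Type*} [CommRing A] {n : ℕ} (y : Fin n → A)
    {F F' : Finset (Fin n)} (h : F ⊆ F') (s : Submonoid.powers (∏ j ∈ F, y j)) :
    IsUnit (Algebra.ofId A (Loc y F') s) := by
  obtain ⟨_, l, rfl⟩ := s
  have h1 : IsUnit (algebraMap A (Loc y F') (∏ j ∈ F, y j)) :=
    isUnit_of_dvd_unit (map_dvd _ (Finset.prod_dvd_prod_of_subset F F' y h))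
      (IsLocalization.Away.algebraMap_isUnit (∏ j ∈ F', y j))
  change IsUnit (algebraMap A (Loc y F') ((∏ j ∈ F, y j) ^ l))
  rw [map_pow]
  exact h1.pow l

/-- The natural map `A_{y_F} → A_{y_F'}` for `F ⊆ F'`. -/
def nat {A : Type*} [CommRing A] {n : ℕ} (y : Fin n → A) {F F' : Finset (Fin n)} (h : F ⊆ F') :
    Loc y F →ₐ[A] Loc y F' :=
  IsLocalization.liftAlgHom (M := Submonoid.powers (∏ j ∈ F, y j)) (f := Algebra.ofId A (Loc y F'))
    (isUnit_algebraMap y h)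

/-- The `t`-th module `⨁_{|F| = t} A_{y_F}` of the Čech complex; it is zero for `t < 0`
and for `t > n`. -/
abbrev Cochain {A : Type*} [CommRing A] {n : ℕ} (y : Fin n → A) (t : ℤ) : Type _ :=
  ∀ F : {F : Finset (Fin n) // (F.card : ℤ) = t}, Loc y F.1

theorem card_erase {n : ℕ} {t u : ℤ} (h : t + 1 = u) (F : {F : Finset (Fin n) // (F.card : ℤ) = u})
    (j : {j // j ∈ F.1}) : ((F.1.erase j.1).card : ℤ) = t := by
  have h1 := Finset.card_erase_add_one j.2
  have h2 := F.2
  omega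

/-- The Čech differential. If `F = {j_1 < ⋯ < j_u}`, its component from `F \ {j_s}` to `F` is
`(-1) ^ (s - 1)` times the natural map; note that `s - 1` is the number of `k ∈ F`
with `k < j_s`. -/
def differential {A : Type*} [CommRing A] {n : ℕ} (y : Fin n → A) {t u : ℤ} (h : t + 1 = u) :
    Cochain y t →ₗ[A] Cochain y u :=
  LinearMap.pi fun F => ∑ j : {j // j ∈ F.1},
    (-1 : A) ^ (F.1.filter (fun k => k < j.1)).card •
      ((nat y (Finset.erase_subset j.1 F.1)).toLinearMap ∘ₗ
        LinearMap.proj (φ := fun F : {F : Finset (Fin n) // (F.card : ℤ) = t} => Loc y F.1)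
          ⟨F.1.erase j.1, card_erase h F j⟩)

theorem nat_nat {A : Type*} [CommRing A] {n : ℕ} (y : Fin n → A) {F F' F'' : Finset (Fin n)}
    (h : F ⊆ F') (h' : F' ⊆ F'') (x : Loc y F) : nat y h' (nat y h x) = nat y (h.trans h') x := by
  have : (nat y h').comp (nat y h) = nat y (h.trans h') :=
    IsLocalization.algHom_ext (Submonoid.powers (∏ j ∈ F, y j)) (by ext)
  rw [← this, AlgHom.comp_apply]

/-- The Čech complex is a complex. -/
theorem differential_differential {A : Type*} [CommRing A] {n : ℕ} (y : Fin n → A) {t u v : ℤ}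
    (h : t + 1 = u) (h' : u + 1 = v) (φ : Cochain y t) :
    differential y h' (differential y h φ) = 0 := by
  classical
  funext F
  let Φ : Finset (Fin n) → Loc y F.1 := fun G =>
    if hG : G ⊆ F.1 ∧ (G.card : ℤ) = t then nat y hG.1 (φ ⟨G, hG.2⟩) else 0
  let ε : Finset (Fin n) → Fin n → A := fun G j => (-1) ^ (G.filter (fun k => k < j)).card
  have key : differential y h' (differential y h φ) F =
      ∑ j ∈ F.1, ∑ k ∈ F.1.erase j,
        (ε F.1 j * ε (F.1.erase j) k) • Φ ((F.1.erase j).erase k) := by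
    rw [← Finset.sum_attach]
    simp only [differential, LinearMap.pi_apply, LinearMap.sum_apply, LinearMap.smul_apply,
      LinearMap.comp_apply, LinearMap.proj_apply, AlgHom.toLinearMap_apply, map_sum, map_smul]
    refine Finset.sum_congr rfl fun j _ => ?_
    rw [← Finset.sum_attach (F.1.erase j.1), Finset.smul_sum]
    refine Finset.sum_congr rfl fun k _ => ?_
    have hc : ((((F.1.erase j.1).erase k.1).card : ℕ) : ℤ) = t :=
      card_erase h ⟨F.1.erase j.1, card_erase h' F j⟩ k
    have hs : (F.1.erase j.1).erase k.1 ⊆ F.1 :=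
      (Finset.erase_subset _ _).trans (Finset.erase_subset _ _)
    simp only [Φ, ε, dif_pos (And.intro hs hc), nat_nat, smul_smul]
  rw [key, Finset.sum_sigma', Pi.zero_apply]
  refine Finset.sum_involution (fun p _ => ⟨p.2, p.1⟩) ?_ ?_ ?_ ?_
  · rintro ⟨j, k⟩ hp
    simp only [Finset.mem_sigma, Finset.mem_erase] at hp
    obtain ⟨hj, hkj, hk⟩ := hp
    simp only
    rw [Finset.erase_right_comm (a := k) (b := j), ← add_smul]
    have hε : ∀ a b : Fin n, a ∈ F.1 → b ∈ F.1 → a < b →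
        ε F.1 a * ε (F.1.erase a) b + ε F.1 b * ε (F.1.erase b) a = 0 := by
      intro a b ha hb hab
      have h1 : (F.1.erase b).filter (fun k => k < a) = F.1.filter (fun k => k < a) := by
        ext x; simp only [Finset.mem_filter, Finset.mem_erase]; grind
      have h2 : (F.1.erase a).filter (fun k => k < b) = (F.1.filter (fun k => k < b)).erase a := by
        ext x; simp only [Finset.mem_filter, Finset.mem_erase]; grind
      have h3 : ((F.1.filter (fun k => k < b)).erase a).card + 1
          = (F.1.filter (fun k => k < b)).card :=
        Finset.card_erase_add_one (Finset.mem_filter.2 ⟨ha, hab⟩)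
      simp only [ε, h1, h2, ← h3, pow_succ]
      ring
    rcases lt_or_gt_of_ne hkj with hlt | hlt
    · rw [add_comm, hε k j hk hj hlt, zero_smul]
    · rw [hε j k hj hk hlt, zero_smul]
  · rintro ⟨j, k⟩ hp _ heq
    simp only [Finset.mem_sigma, Finset.mem_erase] at hp
    simp only [Sigma.mk.injEq] at heq
    exact hp.2.1 heq.1
  · rintro ⟨j, k⟩ hp
    simp only [Finset.mem_sigma, Finset.mem_erase] at hp ⊢
    exact ⟨hp.2.2, fun e => hp.2.1 e.symm, hp.1⟩
  · rintro ⟨j, k⟩ _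
    rfl

/-- The Čech cocycles in cohomological degree `i`. -/
abbrev Cocycles {A : Type*} [CommRing A] {n : ℕ} (y : Fin n → A) (i : ℤ) :
    Submodule A (Cochain y i) :=
  LinearMap.ker (differential y (rfl : i + 1 = i + 1))

/-- The `i`-th cohomology of the Čech complex of `y_1, …, y_n`, that is, the `i`-th local
cohomology `H^i_P(A)` of the Noetherian ring `A` with respect to `P = (y_1, …, y_n)`. -/
abbrev LocalCohomology {A : Type*} [CommRing A] {n : ℕ} (y : Fin n → A) (i : ℤ) : Type _ :=
  Cocycles y i ⧸
    (LinearMap.range (differential y (sub_add_cancel i 1))).submoduleOf (Cocycles y i)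

/-- The component of degree `d` of `A_{y_F}`, where `𝒜` is the grading of `A` and `y j` is
homogeneous of degree `e j`: it consists of the fractions `r / (y_F) ^ l`
with `r` homogeneous and `deg r - l * deg y_F = d`. -/
def locComponent {K A ι : Type*} [Field K] [CommRing A] [Algebra K A] [AddCommGroup ι]
    (𝒜 : ι → Submodule K A) {n : ℕ} (y : Fin n → A) (e : Fin n → ι) (d : ι)
    (F : Finset (Fin n)) : Submodule K (Loc y F) :=
  Submodule.span K {z | ∃ (c : ι) (r : A) (l : ℕ), r ∈ 𝒜 c ∧ c - l • (∑ j ∈ F, e j) = d ∧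
    z = Localization.mk r (⟨∏ j ∈ F, y j, Submonoid.mem_powers _⟩ ^ l)}

/-- The component of degree `d` of the `t`-th module of the Čech complex. -/
def cochainComponent {K A ι : Type*} [Field K] [CommRing A] [Algebra K A] [AddCommGroup ι]
    (𝒜 : ι → Submodule K A) {n : ℕ} (y : Fin n → A) (e : Fin n → ι) (t : ℤ) (d : ι) :
    Submodule K (Cochain y t) :=
  Submodule.pi Set.univ fun F => locComponent 𝒜 y e d F.1

/-- The component of degree `d` of the local cohomology: the classes of the cocycles which are
homogeneous of degree `d`. -/
def cohomologyComponent {K A ι : Type*} [Field K] [CommRing A] [Algebra K A] [AddCommGroup ι]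
    (𝒜 : ι → Submodule K A) {n : ℕ} (y : Fin n → A) (e : Fin n → ι) (i : ℤ) (d : ι) :
    Submodule K (LocalCohomology y i) :=
  ((cochainComponent 𝒜 y e i d).comap ((Cocycles y i).subtype.restrictScalars K)).map
    ((Submodule.mkQ _).restrictScalars K)

end Cech

namespace StanleyReisner

/-- The bidegrees `deg x_i = (1, 0)` and `deg y_j = (0, 1)`. -/
def bidegree (m n : ℕ) : Fin m ⊕ Fin n → ℤ × ℤ :=
  Sum.elim (fun _ => (1, 0)) (fun _ => (0, 1))

/-- `H^i_P(K[Δ])_{(k,j)}` for `P = (y_1, …, y_n)`, where `K[Δ]` has the bigrading with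
`deg x_i = (1, 0)` and `deg y_j = (0, 1)`. -/
def bigradedLocalCohomology (K : Type*) [Field K] {m n : ℕ}
    (Δ : PreAbstractSimplicialComplex (Fin m ⊕ Fin n)) (i k j : ℤ) :
    Submodule K (Cech.LocalCohomology (fun l : Fin n => var K Δ (Sum.inr l)) i) :=
  Cech.cohomologyComponent (component K Δ (bidegree m n)) (fun l : Fin n => var K Δ (Sum.inr l))
    (fun l => bidegree m n (Sum.inr l)) i (k, j)

/-- `H^i_𝔪(K[Γ])_j` for `𝔪 = (y_1, …, y_n)` and a simplicial complex `Γ` on the vertices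
`w_1, …, w_n`, where `K[Γ]` has the standard grading with `deg y_j = 1`. -/
def gradedLocalCohomology (K : Type*) [Field K] {n : ℕ}
    (Γ : PreAbstractSimplicialComplex (Fin n)) (i j : ℤ) :
    Submodule K (Cech.LocalCohomology (var K Γ) i) :=
  Cech.cohomologyComponent (component K Γ (fun _ => (1 : ℤ))) (var K Γ) (fun _ => 1) i j

end StanleyReisner

end

/-!
The projection `g : K[Δ] → K[Δ_W]`, which sends every `x_i` to `0`, is split by the inclusion
`f : K[Δ_W] → K[Δ]`. Both carry `y_j` to `y_j`, so they induce maps between the two Čech complexes,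
and both respect degrees: `f` takes degree `j` to `(0, j)`, and `g` takes `(k, j)` to `j`.
As `g ∘ f = id`, the map `f` is injective on cohomology (`cohomologyMap_leftInverse`). Conversely, an
element of `K[Δ]` of degree `(0, c)` is represented by a polynomial in the `Y_j` alone, and is
therefore fixed by `f ∘ g`. The denominators `y_F ^ l` have degree `(0, *)`, so `f ∘ g` also fixes
every Čech cochain `z` of degree `(0, j)`. If such a `z` is a cocycle, then it is the image under
`f` of the homogeneous cocycle `g z`; hence `f` maps the degree `j` part of the cohomology onto
the degree `(0, j)` part (`map_cohomologyComponent`).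
-/

noncomputable section

/-! ### Functoriality of the Čech complex -/

namespace Cech

section Functoriality

variable {K A B : Type*} [Field K] [CommRing A] [Algebra K A] [CommRing B] [Algebra K B]
  {n : ℕ} {y : Fin n → A} {y' : Fin n → B}

theorem powers_le_comap (f : A →ₐ[K] B) (hf : ∀ j, f (y j) = y' j) (F : Finset (Fin n)) :
    Submonoid.powers (∏ j ∈ F, y j) ≤ (Submonoid.powers (∏ j ∈ F, y' j)).comap f.toRingHom := by
  rw [Submonoid.powers_le]
  exact ⟨1, by simp [hf]⟩

/-- The homomorphism `A_{y_F} → B_{y'_F}` induced by a homomorphism `A → B` carrying `y` to `y'`. -/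
def locMap (f : A →ₐ[K] B) (hf : ∀ j, f (y j) = y' j) (F : Finset (Fin n)) :
    Loc y F →ₐ[K] Loc y' F where
  toRingHom := IsLocalization.map (Loc y' F) f.toRingHom (powers_le_comap f hf F)
  commutes' c := by
    rw [IsScalarTower.algebraMap_apply K A (Loc y F), IsScalarTower.algebraMap_apply K B (Loc y' F)]
    exact (IsLocalization.map_eq (powers_le_comap f hf F) _).trans (congrArg _ (f.commutes c))

theorem locMap_algebraMap (f : A →ₐ[K] B) (hf : ∀ j, f (y j) = y' j) (F : Finset (Fin n)) (a : A) :
    locMap f hf F (algebraMap A _ a) = algebraMap B _ (f a) :=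
  IsLocalization.map_eq (powers_le_comap f hf F) a

theorem locMap_mk (f : A →ₐ[K] B) (hf : ∀ j, f (y j) = y' j) (F : Finset (Fin n)) (a : A) (l : ℕ) :
    locMap f hf F (Localization.mk a (⟨∏ j ∈ F, y j, Submonoid.mem_powers _⟩ ^ l)) =
      Localization.mk (f a) (⟨∏ j ∈ F, y' j, Submonoid.mem_powers _⟩ ^ l) := by
  rw [Localization.mk_eq_mk', Localization.mk_eq_mk']
  refine (IsLocalization.map_mk' (powers_le_comap f hf F) _ _).trans ?_
  congr 1
  ext
  simp [hf]

theorem locMap_smul (f : A →ₐ[K] B) (hf : ∀ j, f (y j) = y' j) (F : Finset (Fin n)) (a : A)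
    (z : Loc y F) : locMap f hf F (a • z) = f a • locMap f hf F z := by
  rw [Algebra.smul_def, map_mul, locMap_algebraMap, Algebra.smul_def]

theorem locMap_nat (f : A →ₐ[K] B) (hf : ∀ j, f (y j) = y' j) {F F' : Finset (Fin n)}
    (h : F ⊆ F') (z : Loc y F) : locMap f hf F' (nat y h z) = nat y' h (locMap f hf F z) := by
  have : ((locMap f hf F' : Loc y F' →+* Loc y' F').comp (nat y h : Loc y F →+* Loc y F')) =
      ((nat y' h : Loc y' F →+* Loc y' F').comp (locMap f hf F : Loc y F →+* Loc y' F)) := by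
    refine IsLocalization.ringHom_ext (Submonoid.powers (∏ j ∈ F, y j)) (RingHom.ext fun a => ?_)
    simp [locMap_algebraMap]
  exact congrArg (fun φ => φ z) this

theorem locMap_leftInverse (f : A →ₐ[K] B) (hf : ∀ j, f (y j) = y' j) (g : B →ₐ[K] A)
    (hg : ∀ j, g (y' j) = y j) (hgf : ∀ a, g (f a) = a) (F : Finset (Fin n)) (z : Loc y F) :
    locMap g hg F (locMap f hf F z) = z := by
  have : ((locMap g hg F : Loc y' F →+* Loc y F).comp (locMap f hf F : Loc y F →+* Loc y' F)) =
      RingHom.id _ := by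
    refine IsLocalization.ringHom_ext (Submonoid.powers (∏ j ∈ F, y j)) (RingHom.ext fun a => ?_)
    simp [locMap_algebraMap, hgf]
  exact congrArg (fun φ => φ z) this

/-- The map of Čech cochains induced by a homomorphism `A → B` carrying `y` to `y'`. -/
def cochainMap (f : A →ₐ[K] B) (hf : ∀ j, f (y j) = y' j) (t : ℤ) :
    Cochain y t →ₗ[K] Cochain y' t :=
  LinearMap.pi fun F => (locMap f hf F.1).toLinearMap ∘ₗ LinearMap.proj F

theorem cochainMap_apply (f : A →ₐ[K] B) (hf : ∀ j, f (y j) = y' j) (t : ℤ) (z : Cochain y t)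
    (F : {F : Finset (Fin n) // (F.card : ℤ) = t}) :
    cochainMap f hf t z F = locMap f hf F.1 (z F) := rfl

theorem cochainMap_differential (f : A →ₐ[K] B) (hf : ∀ j, f (y j) = y' j) {t u : ℤ}
    (h : t + 1 = u) (z : Cochain y t) :
    cochainMap f hf u (differential y h z) = differential y' h (cochainMap f hf t z) := by
  funext F
  rw [cochainMap_apply]
  simp only [differential, LinearMap.pi_apply, LinearMap.sum_apply, LinearMap.smul_apply,
    LinearMap.comp_apply, LinearMap.proj_apply, AlgHom.toLinearMap_apply, map_sum]
  refine Finset.sum_congr rfl fun j _ => ?_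
  rw [locMap_smul, locMap_nat, cochainMap_apply, map_pow, map_neg, map_one]

theorem cochainMap_mem_cocycles (f : A →ₐ[K] B) (hf : ∀ j, f (y j) = y' j) {i : ℤ}
    {z : Cochain y i} (hz : z ∈ Cocycles y i) : cochainMap f hf i z ∈ Cocycles y' i := by
  rw [LinearMap.mem_ker] at hz ⊢
  rw [← cochainMap_differential, hz, map_zero]

/-- The map of Čech cocycles induced by a homomorphism `A → B` carrying `y` to `y'`. -/
def cocycleMap (f : A →ₐ[K] B) (hf : ∀ j, f (y j) = y' j) (i : ℤ) :
    Cocycles y i →ₗ[K] Cocycles y' i where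
  toFun z := ⟨cochainMap f hf i z.1, cochainMap_mem_cocycles f hf z.2⟩
  map_add' z w := Subtype.ext (map_add (cochainMap f hf i) z.1 w.1)
  map_smul' c z := Subtype.ext (map_smul (cochainMap f hf i) c z.1)

/-- The `K`-linear map of local cohomology induced by a homomorphism `A → B` carrying `y` to `y'`.
The two cohomologies are modules over different rings, so they are compared as quotients of
`K`-modules. -/
def cohomologyMap (f : A →ₐ[K] B) (hf : ∀ j, f (y j) = y' j) (i : ℤ) :
    LocalCohomology y i →ₗ[K] LocalCohomology y' i :=
  (Submodule.Quotient.restrictScalarsEquiv K _).toLinearMap ∘ₗ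
    Submodule.mapQ (Submodule.restrictScalars K
        ((LinearMap.range (differential y (sub_add_cancel i 1))).submoduleOf (Cocycles y i)))
      (Submodule.restrictScalars K
        ((LinearMap.range (differential y' (sub_add_cancel i 1))).submoduleOf (Cocycles y' i)))
      (cocycleMap f hf i) (by
        rintro z ⟨w, hw⟩
        exact ⟨cochainMap f hf _ w, (cochainMap_differential f hf _ w).symm.trans
          (congrArg (cochainMap f hf i) hw)⟩) ∘ₗ
    (Submodule.Quotient.restrictScalarsEquiv K _).symm.toLinearMap

theorem cohomologyMap_mk (f : A →ₐ[K] B) (hf : ∀ j, f (y j) = y' j) (i : ℤ) (z : Cocycles y i) :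
    cohomologyMap f hf i (Submodule.Quotient.mk z) =
      Submodule.Quotient.mk (cocycleMap f hf i z) := rfl

theorem cohomologyMap_leftInverse (f : A →ₐ[K] B) (hf : ∀ j, f (y j) = y' j) (g : B →ₐ[K] A)
    (hg : ∀ j, g (y' j) = y j) (hgf : ∀ a, g (f a) = a) (i : ℤ) :
    Function.LeftInverse (cohomologyMap g hg i) (cohomologyMap f hf i) := by
  intro x
  obtain ⟨z, rfl⟩ := Submodule.Quotient.mk_surjective _ x
  rw [cohomologyMap_mk, cohomologyMap_mk]
  congr 1
  exact Subtype.ext (funext fun F => locMap_leftInverse f hf g hg hgf F.1 _)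

/-! ### Homogeneous components -/

variable {ι ι' : Type*} [AddCommGroup ι] [AddCommGroup ι'] {𝒜 : ι → Submodule K A}
  {ℬ : ι' → Submodule K B} {e : Fin n → ι} {e' : Fin n → ι'}

theorem locMap_mem_locComponent (f : A →ₐ[K] B) (hf : ∀ j, f (y j) = y' j) (φ : ι →+ ι')
    (he : ∀ j, φ (e j) = e' j) (hφ : ∀ c, ∀ a ∈ 𝒜 c, f a ∈ ℬ (φ c)) {d : ι} {F : Finset (Fin n)}
    {z : Loc y F} (hz : z ∈ locComponent 𝒜 y e d F) :
    locMap f hf F z ∈ locComponent ℬ y' e' (φ d) F := by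
  induction hz using Submodule.span_induction with
  | mem z hz =>
    obtain ⟨c, r, l, hr, rfl, rfl⟩ := hz
    exact Submodule.subset_span ⟨φ c, f r, l, hφ c r hr, by simp [he], locMap_mk f hf F r l⟩
  | zero => simp
  | add z w _ _ hz hw => rw [map_add]; exact add_mem hz hw
  | smul c z _ hz => rw [map_smul]; exact Submodule.smul_mem _ c hz

theorem cochainMap_mem_cochainComponent (f : A →ₐ[K] B) (hf : ∀ j, f (y j) = y' j) (φ : ι →+ ι')
    (he : ∀ j, φ (e j) = e' j) (hφ : ∀ c, ∀ a ∈ 𝒜 c, f a ∈ ℬ (φ c)) {t : ℤ} {d : ι}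
    {z : Cochain y t} (hz : z ∈ cochainComponent 𝒜 y e t d) :
    cochainMap f hf t z ∈ cochainComponent ℬ y' e' t (φ d) :=
  fun F hF => locMap_mem_locComponent f hf φ he hφ (hz F hF)

theorem locMap_locMap_of_mem_locComponent (f : A →ₐ[K] B) (hf : ∀ j, f (y j) = y' j)
    (g : B →ₐ[K] A) (hg : ∀ j, g (y' j) = y j) {d : ι'} {F : Finset (Fin n)}
    (hfg : ∀ (c : ι') (l : ℕ), c - l • (∑ j ∈ F, e' j) = d → ∀ b ∈ ℬ c, f (g b) = b)
    {z : Loc y' F} (hz : z ∈ locComponent ℬ y' e' d F) :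
    locMap f hf F (locMap g hg F z) = z := by
  induction hz using Submodule.span_induction with
  | mem z hz =>
    obtain ⟨c, r, l, hr, hd, rfl⟩ := hz
    rw [locMap_mk, locMap_mk, hfg c l hd r hr]
  | zero => simp
  | add z w _ _ hz hw => rw [map_add, map_add, hz, hw]
  | smul c z _ hz => rw [map_smul, map_smul, hz]

/-- Suppose that `f : A → B` and `g : B → A` respect degrees, and that `f ∘ g` is the identity on
those components of `B` whose elements occur as numerators in the cochains of degree `φ d`.
Then `f` maps the degree `d` part of the cohomology onto the degree `φ d` part. -/
theorem map_cohomologyComponent (f : A →ₐ[K] B) (hf : ∀ j, f (y j) = y' j) (g : B →ₐ[K] A)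
    (hg : ∀ j, g (y' j) = y j) (φ : ι →+ ι') (he : ∀ j, φ (e j) = e' j)
    (hφ : ∀ c, ∀ a ∈ 𝒜 c, f a ∈ ℬ (φ c)) (ψ : ι' →+ ι) (he' : ∀ j, ψ (e' j) = e j)
    (hψ : ∀ c, ∀ b ∈ ℬ c, g b ∈ 𝒜 (ψ c)) (d : ι) (hd : ψ (φ d) = d)
    (hfg : ∀ (F : Finset (Fin n)) (c : ι') (l : ℕ), c - l • (∑ j ∈ F, e' j) = φ d →
      ∀ b ∈ ℬ c, f (g b) = b) (i : ℤ) :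
    (cohomologyComponent 𝒜 y e i d).map (cohomologyMap f hf i) =
      cohomologyComponent ℬ y' e' i (φ d) := by
  apply le_antisymm
  · rintro _ ⟨_, ⟨z, hz, rfl⟩, rfl⟩
    exact ⟨cocycleMap f hf i z, cochainMap_mem_cochainComponent f hf φ he hφ hz, rfl⟩
  · rintro _ ⟨z, hz, rfl⟩
    refine ⟨_, ⟨cocycleMap g hg i z, ?_, rfl⟩, ?_⟩
    · have h := cochainMap_mem_cochainComponent g hg ψ he' hψ hz
      rwa [hd] at h
    · refine congrArg Submodule.Quotient.mk (Subtype.ext (funext fun F => ?_))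
      exact locMap_locMap_of_mem_locComponent f hf g hg (hfg F.1) (hz F trivial)

end Functoriality

end Cech

/-! ### Inclusion and projection of face rings -/

namespace StanleyReisner

open MvPolynomial

theorem isWeightedHomogeneous_aeval {K σ τ ι ι' : Type*} [Field K] [AddCommMonoid ι]
    [AddCommMonoid ι'] {w : σ → ι} {w' : τ → ι'} (φ : ι →+ ι') {s : σ → MvPolynomial τ K}
    (hs : ∀ v, IsWeightedHomogeneous w' (s v) (φ (w v))) {p : MvPolynomial σ K} {d : ι}
    (hp : IsWeightedHomogeneous w p d) : IsWeightedHomogeneous w' (aeval s p) (φ d) := by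
  rw [aeval_def, eval₂_eq]
  refine IsWeightedHomogeneous.sum _ _ _ fun a ha => ?_
  rw [← hp (mem_support_iff.1 ha), ← zero_add (φ _)]
  refine (isWeightedHomogeneous_C w' _).mul ?_
  rw [Finsupp.weight_apply, Finsupp.sum, map_sum]
  refine IsWeightedHomogeneous.prod _ _ _ fun v _ => ?_
  rw [map_nsmul]
  exact (hs v).pow _

/-- The polynomial ring homomorphism which sends `X_i` to `0` and `Y_j` to `Y_j`. -/
def polyProj (K : Type*) [Field K] (m n : ℕ) :
    MvPolynomial (Fin m ⊕ Fin n) K →ₐ[K] MvPolynomial (Fin n) K :=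
  aeval (Sum.elim (fun _ => 0) X)

/-- The inclusion `K[Y] → K[X, Y]`. -/
def polyIncl (K : Type*) [Field K] (m n : ℕ) :
    MvPolynomial (Fin n) K →ₐ[K] MvPolynomial (Fin m ⊕ Fin n) K :=
  aeval (fun j => X (Sum.inr j))

section

variable (K : Type*) [Field K] {m n : ℕ} (Δ : PreAbstractSimplicialComplex (Fin m ⊕ Fin n))

theorem ideal_le_comap_polyIncl :
    ideal K (restrictRight Δ) ≤ (ideal K Δ).comap (polyIncl K m n) := by
  refine Ideal.span_le.2 ?_
  rintro _ ⟨F, hF, hFΔ, rfl⟩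
  exact Ideal.subset_span ⟨F.map Function.Embedding.inr, hF.map, hFΔ, by simp [polyIncl]⟩

theorem ideal_le_comap_polyProj :
    ideal K Δ ≤ (ideal K (restrictRight Δ)).comap (polyProj K m n) := by
  refine Ideal.span_le.2 ?_
  rintro _ ⟨F, hF, hFΔ, rfl⟩
  rw [SetLike.mem_coe, Ideal.mem_comap, map_prod]
  by_cases h : ∃ k, Sum.inl k ∈ F
  · obtain ⟨k, hk⟩ := h
    rw [Finset.prod_eq_zero hk (by simp [polyProj])]
    exact zero_mem _
  · -- A non-face without vertices in `V` is the image of a non-face of `Δ_W`.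
    obtain ⟨G, rfl⟩ : ∃ G : Finset (Fin n), G.map Function.Embedding.inr = F := by
      refine ⟨F.toRight, ?_⟩
      ext (k | k)
      · simpa using fun hk => h ⟨k, hk⟩
      · simp
    exact Ideal.subset_span ⟨G, Finset.map_nonempty.1 hF, hFΔ, by simp [polyProj]⟩

/-- The inclusion `K[Δ_W] → K[Δ]`. -/
def incl : FaceRing K (restrictRight Δ) →ₐ[K] FaceRing K Δ :=
  Ideal.quotientMapₐ _ (polyIncl K m n) (ideal_le_comap_polyIncl K Δ)

/-- The projection `K[Δ] → K[Δ_W]` which sends every `x_i` to `0`. -/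
def proj : FaceRing K Δ →ₐ[K] FaceRing K (restrictRight Δ) :=
  Ideal.quotientMapₐ _ (polyProj K m n) (ideal_le_comap_polyProj K Δ)

theorem incl_mk (p : MvPolynomial (Fin n) K) :
    incl K Δ (Ideal.Quotient.mk _ p) = Ideal.Quotient.mk _ (polyIncl K m n p) := rfl

theorem proj_mk (p : MvPolynomial (Fin m ⊕ Fin n) K) :
    proj K Δ (Ideal.Quotient.mk _ p) = Ideal.Quotient.mk _ (polyProj K m n p) := rfl

theorem incl_var (j : Fin n) : incl K Δ (var K (restrictRight Δ) j) = var K Δ (Sum.inr j) := by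
  rw [var, incl_mk, polyIncl, aeval_X, var]

theorem proj_var_inr (j : Fin n) :
    proj K Δ (var K Δ (Sum.inr j)) = var K (restrictRight Δ) j := by
  rw [var, proj_mk, polyProj, aeval_X, var, Sum.elim_inr]

theorem proj_incl (a : FaceRing K (restrictRight Δ)) : proj K Δ (incl K Δ a) = a := by
  obtain ⟨p, rfl⟩ := Ideal.Quotient.mk_surjective a
  have h : (polyProj K m n).comp (polyIncl K m n) = AlgHom.id K _ := by
    ext j; simp [polyProj, polyIncl]
  rw [incl_mk, proj_mk]
  exact congrArg _ (congrArg (fun φ => φ p) h)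

theorem incl_mem_component {c : ℤ} {a : FaceRing K (restrictRight Δ)}
    (ha : a ∈ component K (restrictRight Δ) (fun _ => (1 : ℤ)) c) :
    incl K Δ a ∈ component K Δ (bidegree m n) (AddMonoidHom.inr ℤ ℤ c) := by
  obtain ⟨p, hp, rfl⟩ := ha
  exact ⟨polyIncl K m n p, isWeightedHomogeneous_aeval (AddMonoidHom.inr ℤ ℤ)
    (fun j => isWeightedHomogeneous_X K _ (Sum.inr j)) hp, rfl⟩

theorem proj_mem_component {c : ℤ × ℤ} {a : FaceRing K Δ}
    (ha : a ∈ component K Δ (bidegree m n) c) :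
    proj K Δ a ∈ component K (restrictRight Δ) (fun _ => (1 : ℤ)) (AddMonoidHom.snd ℤ ℤ c) := by
  obtain ⟨p, hp, rfl⟩ := ha
  refine ⟨polyProj K m n p, isWeightedHomogeneous_aeval (AddMonoidHom.snd ℤ ℤ) ?_ hp, rfl⟩
  rintro (k | k)
  · exact isWeightedHomogeneous_zero K _ _
  · exact isWeightedHomogeneous_X K _ k

theorem polyIncl_polyProj {c : ℤ × ℤ} (hc : c.1 = 0) {p : MvPolynomial (Fin m ⊕ Fin n) K}
    (hp : IsWeightedHomogeneous (bidegree m n) p c) :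
    polyIncl K m n (polyProj K m n p) = p := by
  have h : ((polyIncl K m n).comp (polyProj K m n) : _ →+* _) p = RingHom.id _ p := by
    refine hom_congr_vars (by ext; simp) ?_ rfl
    rintro (k | k) hk _
    · -- The first degree of a monomial is the sum of its exponents at the `X_k`.
      obtain ⟨a, ha, hka⟩ := (mem_vars_iff_mem_support _).1 hk
      have h1 := congrArg Prod.fst (hp (mem_support_iff.1 ha))
      rw [hc, Finsupp.weight_apply, Finsupp.sum, Prod.fst_sum,
        Finset.sum_eq_zero_iff_of_nonneg] at h1
      · exact absurd (h1 _ hka) (by simpa [bidegree] using hka)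
      · rintro (l | l) _ <;> simp [bidegree]
    · simp [polyIncl, polyProj]
  exact h

theorem incl_proj {c : ℤ × ℤ} (hc : c.1 = 0) {a : FaceRing K Δ}
    (ha : a ∈ component K Δ (bidegree m n) c) : incl K Δ (proj K Δ a) = a := by
  obtain ⟨p, hp, rfl⟩ := ha
  exact congrArg (Ideal.Quotient.mk _) (polyIncl_polyProj K hc hp)

end

end StanleyReisner

end

theorem mainTheorem11 (K : Type*) [Field K] (m n : ℕ)
    (Δ : PreAbstractSimplicialComplex (Fin m ⊕ Fin n)) (i j : ℤ) :
    Module.rank K (StanleyReisner.bigradedLocalCohomology K Δ i 0 j) =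
      Module.rank K (StanleyReisner.gradedLocalCohomology K (StanleyReisner.restrictRight Δ) i j) := by
  have hinj := (Cech.cohomologyMap_leftInverse (StanleyReisner.incl K Δ)
    (StanleyReisner.incl_var K Δ) (StanleyReisner.proj K Δ) (StanleyReisner.proj_var_inr K Δ)
    (StanleyReisner.proj_incl K Δ) i).injective
  have hmap : (StanleyReisner.gradedLocalCohomology K (StanleyReisner.restrictRight Δ) i j).map
      (Cech.cohomologyMap (StanleyReisner.incl K Δ) (StanleyReisner.incl_var K Δ) i) =
      StanleyReisner.bigradedLocalCohomology K Δ i 0 j := by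
    refine Cech.map_cohomologyComponent (StanleyReisner.incl K Δ) (StanleyReisner.incl_var K Δ)
      (StanleyReisner.proj K Δ) (StanleyReisner.proj_var_inr K Δ) (AddMonoidHom.inr ℤ ℤ)
      (fun _ => rfl) (fun _ _ => StanleyReisner.incl_mem_component K Δ) (AddMonoidHom.snd ℤ ℤ)
      (fun _ => rfl) (fun _ _ => StanleyReisner.proj_mem_component K Δ) j rfl ?_ i
    intro F c l hc b hb
    -- The denominators have first degree `0`, so the numerators do as well.
    refine StanleyReisner.incl_proj K Δ ?_ hb
    have h1 := congrArg Prod.fst hc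
    simpa [StanleyReisner.bidegree, Prod.fst_sum] using h1
  rw [← hmap]
  exact (Submodule.equivMapOfInjective _ hinj _).rank_eq.symm
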